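/- A polynomial $r(z,\bar w)=\sum_{a,b} c_{ab}\,z^a\bar w^b$ ($z,w\in\mathbb C$, $c_{ab}\in\mathbb C$, finite sum) is called Hermitian symmetric if $r(z,\bar w)=\overline{r(w,\bar z)}$ for all $z,w\in\mathbb C$; then $r(z,\bar z)$ is real for all $z$. A squared norm is a Hermitian symmetric polynomial of the form $\|F(z)\|^2=\sum_{j=1}^N|F_j(z)|^2$, where $F=(F_1,\dots,F_N)$ is a holomorphic polynomial mapping (each $F_j\in\mathbb C[z]$, $N\ge 0$). Let $\mathcal Q$ be the set of Hermitian symmetric polynomials that are quotients of squared norms, i.e. $r(z,\bar z)=\|F(z)\|^2/\|G(z)\|^2$ wherever $G(z)\neq 0$, for some holomorphic polynomial mappings $F,G$ with $G\not\equiv 0$. Let $r(z,\bar z)$ be a Hermitian symmetric polynomial in one variable. Then $r\in\mathcal Q$ if and only if one of the following holds: either $r$ vanishes identically, or the zero set $\{z\in\mathbb C: r(z,\bar z)=0\}$ is a finite (possibly empty) set $\{p_1,\dots,p_K\}$ (repetitions allowed in the list) such that $$ r(z,\bar z)=\prod_{j=1}^K|z-p_j|^2\; s(z,\bar z), $$ where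 $s$ is a Hermitian symmetric polynomial satisfying both of the following conditions: 1) $s$ is strictly positive, i.e. $s(z,\bar z)>0$ for all $z\in\mathbb C$; 2) the total degree of $s$ (as a polynomial in $z$ and $\bar z$) is twice the degree of $s$ in $z$. -/

import Mathlib

open ComplexConjugate

namespace HermPoly

/-- A polynomial `r(z, w̄)` in one complex variable and one conjugate variable:
`X 0` stands for `z`, and `X 1` for the conjugated variable. -/
abbrev BiPoly : Type := MvPolynomial (Fin 2) ℂ

/-- The polarized value `r(z, w̄)`. -/
noncomputable def pol (r : BiPoly) (z w : ℂ) : ℂ :=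
  MvPolynomial.eval ![z, conj w] r

/-- The value `r(z, z̄)`. -/
noncomputable def val (r : BiPoly) (z : ℂ) : ℂ := pol r z z

/-- `r(z, w̄)` is the conjugate of `r(w, z̄)` for all `z, w`. -/
def IsHermitianSymm (r : BiPoly) : Prop :=
  ∀ z w : ℂ, pol r z w = conj (pol r w z)

/-- The squared norm `‖F(z)‖²` of a holomorphic polynomial mapping `F : ℂ → ℂ^N`. -/
noncomputable def sqNorm {N : ℕ} (F : Fin N → Polynomial ℂ) (z : ℂ) : ℝ :=
  ∑ j, ‖(F j).eval z‖ ^ 2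

/-- The Hermitian symmetric polynomials that are squared norms of holomorphic
polynomial mappings. -/
def PInfty : Set BiPoly :=
  {r | IsHermitianSymm r ∧
    ∃ (N : ℕ) (F : Fin N → Polynomial ℂ), ∀ z : ℂ, val r z = (sqNorm F z : ℂ)}

/-- The Hermitian symmetric polynomials that are quotients of squared norms: `r = p / q` with
`p, q` squared norms and `q` not identically zero, the quotient being taken
wherever the denominator does not vanish. -/
def Q : Set BiPoly :=
  {r | IsHermitianSymm r ∧
    ∃ p ∈ PInfty, ∃ q ∈ PInfty, q ≠ 0 ∧
      ∀ z : ℂ, val q z ≠ 0 → val r z = val p z / val q z}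

/-- `s` is Hermitian symmetric and its (real) values `s(z, z̄)` are all positive. -/
def IsStrictlyPositive (s : BiPoly) : Prop :=
  IsHermitianSymm s ∧ ∀ z : ℂ, 0 < (val s z).re

/-- The polynomial `|z - p|² = (z - p)(z̄ - p̄)`. -/
noncomputable def absSqSub (p : ℂ) : BiPoly :=
  (MvPolynomial.X 0 - MvPolynomial.C p) * (MvPolynomial.X 1 - MvPolynomial.C (conj p))

end HermPoly

/-! Necessity. Clearing denominators gives `r * sqPoly G = sqPoly F`. If all components of `F`
vanish at `p`, then `|z - p|²` splits off `sqPoly F`; it is cancelled against `G` when `G(p) = 0`,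
and otherwise `z - p`, being prime, divides `r`, and Hermitian symmetry brings in the conjugate
factor. Induction on the degree of `sqPoly F` reduces to `F` without common zeros, where `r` is
positive. A nonzero squared norm has a nonzero coefficient at `z^m z̄^m`, `m` its degree in `z`, so
its total degree is twice its degree in `z`; both degrees are additive, so `r` inherits the relation
(`exists_factorization`).

Sufficiency. If `s` has degree `d` in `z`, the degree condition forces the coefficient of `|z|^(2d)`
to be nonzero. This is positivity at infinity, so the bihomogenization of `s` is positive on the
unit sphere of `ℂ²`. It remains to show that `(1 + |z|²)^N s` is a squared norm for large `N`, i.e.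
that its coefficient matrix is positive semidefinite. Up to positive diagonal scaling, this matrix
is that of the form `f ↦ ∫ σ |f|²` on homogeneous polynomials of degree `N + d` over the sphere. The
symbol `σ` comes from rewriting `z^a ∂^b` with derivatives on the left. Its leading term is `(N + 2d
+ 1)!` times the bihomogenization, with an error `O((N + 2d)!)`, so it has nonnegative real part for
large `N` (`integral_toeplitzSymbol`, `exists_toeplitzSymbol_nonneg`). -/

namespace HermPoly

open MeasureTheory

/-! ### Reordering `z^a ∂^b` and factorial sums -/

/-- The coefficients of the rewriting `z^a ∂^b = ∑ₖ orderCoeff a b k • ∂^(b-k) z^(a-k)`. -/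
def orderCoeff (a b k : ℕ) : ℤ := (-1) ^ k * a.choose k * b.descFactorial k

theorem cast_descFactorial_succ (b k : ℕ) :
    (b.descFactorial (k + 1) : ℤ) = ((b : ℤ) - k) * b.descFactorial k := by
  rw [Nat.descFactorial_succ]
  rcases le_or_gt k b with h | h
  · push_cast [Nat.cast_sub h]; ring
  · simp [Nat.descFactorial_eq_zero_iff_lt.2 h]

/-- In the Fock inner product, where `z^n` has squared norm `n!`, the adjoint of `∂` is `z`. With `n
= i + a`, the left side is the reordered form of `⟨z^a ∂^b z^i, z^(i+a-b)⟩`. -/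
theorem sum_orderCoeff_mul_factorial (a b n : ℕ) (h : a ≤ n) :
    ∑ k ∈ Finset.range (a + 1), orderCoeff a b k * ((n - k).factorial : ℤ) =
      (∏ t ∈ Finset.range a, ((n : ℤ) - b - t)) * ((n - a).factorial : ℤ) := by
  induction a generalizing n with
  | zero => simp [orderCoeff]
  | succ a ih =>
    obtain ⟨m, rfl⟩ : ∃ m, n = m + 1 := ⟨n - 1, by omega⟩
    have ham : a ≤ m := by omega
    -- Pascal's rule in `a` splits the sum in two; the terms of index `k` then combine through `(m +
    -- 1 - k) - (b - k) = m + 1 - b`.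
    have key : ∑ k ∈ Finset.range (a + 1 + 1),
          orderCoeff (a + 1) b k * ((m + 1 - k).factorial : ℤ) =
        ((m : ℤ) + 1 - b) *
          ∑ k ∈ Finset.range (a + 1), orderCoeff a b k * ((m - k).factorial : ℤ) := by
      have e1 : ∑ k ∈ Finset.range (a + 1 + 1),
            orderCoeff (a + 1) b k * ((m + 1 - k).factorial : ℤ) =
          ∑ k ∈ Finset.range (a + 1), orderCoeff a b k * ((m + 1 - k).factorial : ℤ) +
          ∑ k ∈ Finset.range (a + 1), (-1) ^ (k + 1) * (a.choose k : ℤ) *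
            b.descFactorial (k + 1) * ((m - k).factorial : ℤ) := by
        rw [Finset.sum_range_succ' _ (a + 1)]
        have e2 : ∑ k ∈ Finset.range (a + 1), orderCoeff a b k * ((m + 1 - k).factorial : ℤ) =
            ∑ k ∈ Finset.range (a + 1),
              orderCoeff a b (k + 1) * ((m + 1 - (k + 1)).factorial : ℤ) +
            orderCoeff a b 0 * ((m + 1 - 0).factorial : ℤ) := by
          rw [← Finset.sum_range_succ' (fun k => orderCoeff a b k * ((m + 1 - k).factorial : ℤ)),
            Finset.sum_range_succ _ (a + 1)]
          simp [orderCoeff]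
        rw [e2, add_right_comm, ← Finset.sum_add_distrib]
        congr 1
        · refine Finset.sum_congr rfl fun k _ => ?_
          simp only [orderCoeff, Nat.choose_succ_succ, Nat.add_sub_add_right]
          push_cast; ring
        · simp [orderCoeff]
      rw [e1, ← Finset.sum_add_distrib, Finset.mul_sum]
      refine Finset.sum_congr rfl fun k hk => ?_
      have hk : k ≤ m := by have := Finset.mem_range.1 hk; omega
      rw [Nat.succ_sub hk, Nat.factorial_succ, cast_descFactorial_succ, orderCoeff]
      push_cast [Nat.cast_sub hk]
      ring
    rw [key, ih m ham, Finset.prod_range_succ']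
    have : m + 1 - (a + 1) = m - a := by omega
    rw [this]
    push_cast
    have : ∏ t ∈ Finset.range a, ((m : ℤ) + 1 - b - (t + 1)) =
        ∏ t ∈ Finset.range a, ((m : ℤ) - b - t) :=
      Finset.prod_congr rfl fun t _ => by ring
    rw [this]; ring

/-- The sum `∑ₖ orderCoeff a b k (n - k)!`; the bound `d` on the summation index is irrelevant
as soon as `a ≤ d`. -/
def orderSum (d a b n : ℕ) : ℤ :=
  ∑ k ∈ Finset.range (d + 1), orderCoeff a b k * ((n - k).factorial : ℤ)

theorem orderSum_eq {d a b n : ℕ} (had : a ≤ d) (h : a ≤ n) :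
    orderSum d a b n =
      (∏ t ∈ Finset.range a, ((n : ℤ) - b - t)) * ((n - a).factorial : ℤ) := by
  rw [← sum_orderCoeff_mul_factorial a b n h, orderSum]
  refine (Finset.sum_subset (Finset.range_subset_range.2 (by omega)) fun k _ hk => ?_).symm
  have : a < k := by simpa using hk
  simp [orderCoeff, Nat.choose_eq_zero_of_lt this]

theorem orderSum_eq_zero {d a b n : ℕ} (had : a ≤ d) (ha : a ≤ n) (hb : b ≤ n) (h : n < a + b) :
    orderSum d a b n = 0 := by
  rw [orderSum_eq had ha, Finset.prod_eq_zero (i := n - b), zero_mul]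
  · simp; omega
  · push_cast [Nat.cast_sub hb]; ring

/-- This is `⟨z^a ∂^b z^(b+k), z^(a+k)⟩ = (b+k)!/k! * (a+k)!` with the denominator cleared. -/
theorem orderSum_mul_factorial {d a b k : ℕ} (had : a ≤ d) :
    orderSum d a b (a + b + k) * (k.factorial : ℤ) =
      ((a + k).factorial : ℤ) * ((b + k).factorial : ℤ) := by
  rw [orderSum_eq had (by omega)]
  have h1 : ∏ t ∈ Finset.range a, (((a + b + k : ℕ) : ℤ) - b - t) =
      ((a + k).descFactorial a : ℤ) := by
    rw [Nat.descFactorial_eq_prod_range]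
    push_cast
    refine Finset.prod_congr rfl fun t ht => ?_
    have := Finset.mem_range.1 ht
    rw [Nat.cast_sub (by omega)]
    push_cast; ring
  have h2 : a + b + k - a = b + k := by omega
  have h3 := Nat.factorial_mul_descFactorial (Nat.le_add_right a k)
  rw [Nat.add_sub_cancel_left] at h3
  rw [h1, h2, ← h3]
  push_cast; ring

/-! ### Moments of the unit sphere of `ℂ²` -/

theorem integral_pow_mul_one_sub_pow (k m : ℕ) :
    ∫ x in (0 : ℝ)..1, x ^ k * (1 - x) ^ m =
      (k.factorial * m.factorial : ℝ) / ((k + m + 1).factorial : ℝ) := by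
  induction m generalizing k with
  | zero =>
    simp only [pow_zero, mul_one, integral_pow, Nat.factorial_zero, Nat.add_zero]
    rw [Nat.factorial_succ]
    have : (k.factorial : ℝ) ≠ 0 := by positivity
    push_cast
    field_simp
    simp
  | succ m ih =>
    have hu : ∀ x ∈ Set.uIcc (0 : ℝ) 1,
        HasDerivAt (fun x : ℝ => (1 - x) ^ (m + 1)) (-((m + 1 : ℕ) * (1 - x) ^ m)) x := by
      intro x _
      have := ((hasDerivAt_id x).const_sub 1).fun_pow (m + 1)
      simpa using this
    have hv : ∀ x ∈ Set.uIcc (0 : ℝ) 1,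
        HasDerivAt (fun x : ℝ => x ^ (k + 1) / (k + 1 : ℕ)) (x ^ k) x := by
      intro x _
      have := (hasDerivAt_pow (k + 1) x).div_const ((k + 1 : ℕ) : ℝ)
      have h0 : ((k + 1 : ℕ) : ℝ) ≠ 0 := by positivity
      rwa [Nat.add_sub_cancel, mul_div_cancel_left₀ _ h0] at this
    have h := intervalIntegral.integral_mul_deriv_eq_deriv_mul hu hv
      (Continuous.intervalIntegrable (by fun_prop) _ _)
      (Continuous.intervalIntegrable (by fun_prop) _ _)
    have e1 : ∫ x in (0 : ℝ)..1, x ^ k * (1 - x) ^ (m + 1) =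
        ((m + 1 : ℕ) / (k + 1 : ℕ) : ℝ) * ∫ x in (0 : ℝ)..1, x ^ (k + 1) * (1 - x) ^ m := by
      rw [← intervalIntegral.integral_const_mul]
      calc _ = ∫ x in (0 : ℝ)..1, (1 - x) ^ (m + 1) * x ^ k := by simp_rw [mul_comm]
        _ = _ := by
          rw [h]
          simp only [sub_self, sub_zero, one_pow, ne_eq, Nat.add_eq_zero_iff, one_ne_zero,
            and_false, not_false_eq_true, zero_pow, zero_mul, zero_div, mul_zero, zero_sub]
          rw [← intervalIntegral.integral_neg]
          congr 1; ext x; ring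
    rw [e1, ih (k + 1), Nat.factorial_succ k, Nat.factorial_succ m,
      show k + 1 + m + 1 = k + (m + 1) + 1 by omega]
    push_cast
    field_simp


/-- The unit sphere of `ℂ²`, modulo the phase of the second coordinate: first coordinate. -/
noncomputable def sphereFst (p : ℝ × ℝ) : ℂ := (√p.1 : ℂ) * Complex.exp (p.2 * Complex.I)

/-- The second, real coordinate of the parametrized sphere. -/
noncomputable def sphereSnd (p : ℝ × ℝ) : ℂ := (√(1 - p.1) : ℂ)

/-- The parameter domain of the sphere. -/
def sphereDomain : Set (ℝ × ℝ) := Set.Icc 0 1 ×ˢ Set.Icc 0 (2 * Real.pi)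

theorem isCompact_sphereDomain : IsCompact sphereDomain := isCompact_Icc.prod isCompact_Icc

@[fun_prop]
theorem continuous_sphereFst : Continuous sphereFst := by unfold sphereFst; fun_prop

@[fun_prop]
theorem continuous_sphereSnd : Continuous sphereSnd := by unfold sphereSnd; fun_prop

theorem norm_sphereFst (p : ℝ × ℝ) : ‖sphereFst p‖ = √p.1 := by
  simp [sphereFst, Complex.norm_exp, abs_of_nonneg (Real.sqrt_nonneg _)]

theorem norm_sphereSnd (p : ℝ × ℝ) : ‖sphereSnd p‖ = √(1 - p.1) := by
  simp [sphereSnd, abs_of_nonneg (Real.sqrt_nonneg _)]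

theorem norm_sphereFst_le {p : ℝ × ℝ} (hp : p ∈ sphereDomain) : ‖sphereFst p‖ ≤ 1 := by
  rw [norm_sphereFst]; exact Real.sqrt_le_one.2 hp.1.2

theorem norm_sphereSnd_le {p : ℝ × ℝ} (hp : p ∈ sphereDomain) : ‖sphereSnd p‖ ≤ 1 := by
  rw [norm_sphereSnd]; exact Real.sqrt_le_one.2 (by linarith [hp.1.1])

theorem conj_sphereSnd (p : ℝ × ℝ) : conj (sphereSnd p) = sphereSnd p := by
  simp [sphereSnd]

/-- In the coordinates `x = |z|²` and `θ = arg z` the integral separates: the angular factor gives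
orthogonality, the radial one a Beta integral. -/
theorem sphere_integral_eq_mul (k l r : ℕ) :
    ∫ p in sphereDomain, sphereFst p ^ k * conj (sphereFst p) ^ l * sphereSnd p ^ r =
      (∫ x in Set.Icc (0 : ℝ) 1, ((√x ^ (k + l) * √(1 - x) ^ r : ℝ) : ℂ)) *
        ∫ θ in Set.Icc (0 : ℝ) (2 * Real.pi),
          Complex.exp ((((k : ℤ) - l : ℤ) : ℂ) * Complex.I * θ) := by
  rw [← setIntegral_prod_mul, sphereDomain, ← Measure.volume_eq_prod]
  congr 1
  ext p
  have h : conj (sphereFst p) = (√p.1 : ℂ) * Complex.exp (-(p.2 * Complex.I)) := by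
    simp [sphereFst, ← Complex.exp_conj]
  have e : Complex.exp ((((k : ℤ) - l : ℤ) : ℂ) * Complex.I * p.2) =
      Complex.exp (p.2 * Complex.I) ^ k * Complex.exp (-(p.2 * Complex.I)) ^ l := by
    rw [← Complex.exp_nat_mul, ← Complex.exp_nat_mul, ← Complex.exp_add]
    congr 1; push_cast; ring
  rw [h, e, sphereFst, sphereSnd]
  push_cast
  ring

theorem sphere_integral_eq_zero {k l : ℕ} (r : ℕ) (h : k ≠ l) :
    ∫ p in sphereDomain, sphereFst p ^ k * conj (sphereFst p) ^ l * sphereSnd p ^ r = 0 := by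
  rw [sphere_integral_eq_mul]
  convert mul_zero _
  have hc : (((k : ℤ) - l : ℤ) : ℂ) * Complex.I ≠ 0 := by
    refine mul_ne_zero ?_ Complex.I_ne_zero
    rw [Int.cast_ne_zero]
    omega
  rw [integral_Icc_eq_integral_Ioc, ← intervalIntegral.integral_of_le (by positivity),
    integral_exp_mul_complex hc]
  have : (((k : ℤ) - l : ℤ) : ℂ) * Complex.I * ((2 * Real.pi : ℝ) : ℂ) =
      (((k : ℤ) - l : ℤ) : ℂ) * (2 * Real.pi * Complex.I) := by push_cast; ring
  rw [this, Complex.exp_int_mul_two_pi_mul_I]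
  simp

theorem sphere_integral_diag (k m : ℕ) :
    ∫ p in sphereDomain, sphereFst p ^ k * conj (sphereFst p) ^ k * sphereSnd p ^ (2 * m) =
      2 * Real.pi * (k.factorial * m.factorial / ((k + m + 1).factorial : ℂ)) := by
  rw [sphere_integral_eq_mul]
  have h1 : ∫ θ in Set.Icc (0 : ℝ) (2 * Real.pi),
          Complex.exp ((((k : ℤ) - k : ℤ) : ℂ) * Complex.I * θ) = 2 * Real.pi := by
    simp [Real.pi_pos.le]
  have h2 : ∫ x in Set.Icc (0 : ℝ) 1, ((√x ^ (k + k) * √(1 - x) ^ (2 * m) : ℝ) : ℂ) =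
      ((∫ x in (0 : ℝ)..1, x ^ k * (1 - x) ^ m : ℝ) : ℂ) := by
    rw [integral_complex_ofReal, intervalIntegral.integral_of_le zero_le_one,
      integral_Icc_eq_integral_Ioc]
    congr 1
    refine setIntegral_congr_fun measurableSet_Ioc fun x hx => ?_
    rw [← two_mul, pow_mul, pow_mul, Real.sq_sqrt hx.1.le, Real.sq_sqrt (by linarith [hx.2])]
  rw [h1, h2, integral_pow_mul_one_sub_pow]
  push_cast; ring


/-! ### The Toeplitz symbol and its matrix -/

theorem integrableOn_sphereDomain {f : ℝ × ℝ → ℂ} (hf : Continuous f) :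
    IntegrableOn f sphereDomain :=
  hf.continuousOn.integrableOn_compact isCompact_sphereDomain

/-- The entry in position `(i, j)` of the matrix of coefficients of `z̄^i z^j` in
`(1 + |z|²)^N ∑ c a b z^a z̄^b`. -/
def gramEntry (c : ℕ → ℕ → ℂ) (d N i j : ℕ) : ℂ :=
  ∑ a ∈ Finset.range (d + 1), ∑ b ∈ Finset.range (d + 1), ∑ k ∈ Finset.range (N + 1),
    if i = b + k ∧ j = a + k then c a b * N.choose k else 0

/-- The function on the sphere whose Toeplitz operator on homogeneous polynomials of degree `N + d`
is, up to a constant, given by the kernel `(1 + |z|²)^N z^a z̄^b`. -/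
noncomputable def toeplitzMonomial (d N a b : ℕ) (p : ℝ × ℝ) : ℂ :=
  ∑ s ∈ Finset.range (d + 1), ∑ t ∈ Finset.range (d + 1),
    ((orderCoeff a b s * orderCoeff (d - a) (d - b) t : ℤ) : ℂ) *
      ((N + d + d + 1 - s - t).factorial : ℂ) *
      (sphereFst p ^ (a - s) * conj (sphereFst p) ^ (b - s) *
        sphereSnd p ^ ((d - a - t) + (d - b - t)))

@[fun_prop]
theorem continuous_toeplitzMonomial (d N a b : ℕ) : Continuous (toeplitzMonomial d N a b) := by
  unfold toeplitzMonomial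
  fun_prop

theorem orderCoeff_eq_zero_left {a b k : ℕ} (h : a < k) : orderCoeff a b k = 0 := by
  simp [orderCoeff, Nat.choose_eq_zero_of_lt h]

theorem orderCoeff_eq_zero_right {a b k : ℕ} (h : b < k) : orderCoeff a b k = 0 := by
  simp [orderCoeff, Nat.descFactorial_eq_zero_iff_lt.2 h]

/-- The factorial `(N + 2d + 1 - s - t)!` in the symbol is exactly the denominator of the Beta
integral. What remains is a product of one term in `s` and one in `t`, so the double sum will factor
into two order sums. Where natural subtraction truncates, an order coefficient is zero. -/
theorem orderCoeff_mul_integral {d N a b i j s t : ℕ} (ha : a ≤ d) (hb : b ≤ d)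
    (hi : i ≤ N + d) (hj : j ≤ N + d) :
    ((orderCoeff a b s * orderCoeff (d - a) (d - b) t : ℤ) : ℂ) *
      ((N + d + d + 1 - s - t).factorial : ℂ) *
      ∫ p in sphereDomain, sphereFst p ^ (a - s + i) * conj (sphereFst p) ^ (b - s + j) *
        sphereSnd p ^ ((d - a - t) + (d - b - t) + ((N + d - i) + (N + d - j))) =
    if i + a = j + b then 2 * Real.pi *
      ((orderCoeff a b s * ((i + a - s).factorial : ℤ) : ℤ) : ℂ) *
      ((orderCoeff (d - a) (d - b) t * ((N + d - i + (d - a) - t).factorial : ℤ) : ℤ) : ℂ)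
    else 0 := by
  rcases lt_or_ge a s with h | has
  · simp [orderCoeff_eq_zero_left h]
  rcases lt_or_ge b s with h | hbs
  · simp [orderCoeff_eq_zero_right h]
  rcases lt_or_ge (d - a) t with h | hat
  · simp [orderCoeff_eq_zero_left h]
  rcases lt_or_ge (d - b) t with h | hbt
  · simp [orderCoeff_eq_zero_right h]
  split_ifs with h
  · rw [show b - s + j = a - s + i by omega,
      show (d - a - t) + (d - b - t) + ((N + d - i) + (N + d - j)) =
        2 * (N + d - i + (d - a) - t) by omega, sphere_integral_diag,
      show a - s + i = i + a - s by omega,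
      show i + a - s + (N + d - i + (d - a) - t) + 1 = N + d + d + 1 - s - t by omega]
    have : ((N + d + d + 1 - s - t).factorial : ℂ) ≠ 0 := by
      exact_mod_cast Nat.factorial_ne_zero _
    push_cast
    field_simp
  · rw [sphere_integral_eq_zero _ (by omega), mul_zero]

/-- The two order sums contribute `1/k!` and `1/(N-k)!`, one for each homogeneous coordinate;
multiplied by `N!` these make the binomial coefficient of `(1 + |z|²)^N`. -/
theorem orderSum_mul_orderSum {d N a b i j : ℕ} (ha : a ≤ d) (hb : b ≤ d)
    (hi : i ≤ N + d) (hj : j ≤ N + d) (h : i + a = j + b) :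
    ((orderSum d a b (i + a) * orderSum d (d - a) (d - b) (N + d - i + (d - a)) : ℤ) : ℂ) *
        (N.factorial : ℂ) =
      ∑ k ∈ Finset.range (N + 1), if i = b + k ∧ j = a + k then
        (N.choose k : ℂ) * (i.factorial * (N + d - i).factorial) *
          (j.factorial * (N + d - j).factorial) else 0 := by
  -- Only `k = i - b` can contribute. If it lies outside `0..N`, the right side is empty and one of
  -- the two order sums vanishes.
  by_cases hk : b ≤ i ∧ i - b ≤ N
  · obtain ⟨hbi, hkN⟩ := hk
    obtain ⟨k, rfl⟩ := Nat.exists_eq_add_of_le hbi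
    obtain rfl : j = a + k := by omega
    have hkN : k ≤ N := by omega
    rw [Finset.sum_eq_single k]
    · rw [if_pos ⟨rfl, rfl⟩]
      have e1 := orderSum_mul_factorial (d := d) (a := a) (b := b) (k := k) ha
      have e2 := orderSum_mul_factorial (d := d) (a := d - a) (b := d - b) (k := N - k) (by omega)
      have e3 := Nat.choose_mul_factorial_mul_factorial hkN
      rw [show b + k + a = a + b + k by omega,
        show N + d - (b + k) + (d - a) = d - a + (d - b) + (N - k) by omega,
        show N + d - (b + k) = d - b + (N - k) by omega,
        show N + d - (a + k) = d - a + (N - k) by omega]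
      have key : orderSum d a b (a + b + k) *
          orderSum d (d - a) (d - b) (d - a + (d - b) + (N - k)) * (N.factorial : ℤ) =
          (N.choose k : ℤ) * ((b + k).factorial * (d - b + (N - k)).factorial) *
          ((a + k).factorial * (d - a + (N - k)).factorial) := by
        rw [← e3]
        push_cast
        linear_combination (N.choose k : ℤ) *
          (orderSum d (d - a) (d - b) (d - a + (d - b) + (N - k)) * ((N - k).factorial : ℤ)) * e1 +
          (N.choose k : ℤ) * ((a + k).factorial * (b + k).factorial) * e2
      exact_mod_cast key
    · intro k' _ hne
      rw [if_neg (by omega)]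
    · intro hmem
      exact absurd (Finset.mem_range.2 (by omega)) hmem
  · rw [Finset.sum_eq_zero]
    · rcases not_and_or.1 hk with hk | hk
      · rw [orderSum_eq_zero (n := i + a) ha (by omega) (by omega) (by omega)]; simp
      · rw [orderSum_eq_zero (n := N + d - i + (d - a)) (by omega) (by omega) (by omega) (by omega)]
        simp
    · intro k hk'
      have := Finset.mem_range.1 hk'
      rw [if_neg (by omega)]

theorem integral_toeplitzMonomial {d N a b i j : ℕ} (ha : a ≤ d) (hb : b ≤ d)
    (hi : i ≤ N + d) (hj : j ≤ N + d) :
    (∫ p in sphereDomain, toeplitzMonomial d N a b p *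
      ((sphereFst p ^ i * sphereSnd p ^ (N + d - i)) *
        conj (sphereFst p ^ j * sphereSnd p ^ (N + d - j)))) =
      2 * Real.pi / N.factorial * ∑ k ∈ Finset.range (N + 1), if i = b + k ∧ j = a + k then
        (N.choose k : ℂ) * (i.factorial * (N + d - i).factorial) *
          (j.factorial * (N + d - j).factorial) else 0 := by
  have hexp : ∀ p, toeplitzMonomial d N a b p *
      ((sphereFst p ^ i * sphereSnd p ^ (N + d - i)) *
        conj (sphereFst p ^ j * sphereSnd p ^ (N + d - j))) =
      ∑ s ∈ Finset.range (d + 1), ∑ t ∈ Finset.range (d + 1),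
      ((orderCoeff a b s * orderCoeff (d - a) (d - b) t : ℤ) : ℂ) *
      ((N + d + d + 1 - s - t).factorial : ℂ) *
      (sphereFst p ^ (a - s + i) * conj (sphereFst p) ^ (b - s + j) *
        sphereSnd p ^ ((d - a - t) + (d - b - t) + ((N + d - i) + (N + d - j)))) := by
    intro p
    simp only [toeplitzMonomial, Finset.sum_mul, map_mul, map_pow, conj_sphereSnd]
    refine Finset.sum_congr rfl fun s _ => Finset.sum_congr rfl fun t _ => ?_
    ring
  simp_rw [hexp]
  rw [integral_finsetSum _ fun s _ => integrableOn_sphereDomain (by fun_prop)]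
  have : ∀ s ∈ Finset.range (d + 1), (∫ p in sphereDomain, ∑ t ∈ Finset.range (d + 1),
      ((orderCoeff a b s * orderCoeff (d - a) (d - b) t : ℤ) : ℂ) *
      ((N + d + d + 1 - s - t).factorial : ℂ) *
      (sphereFst p ^ (a - s + i) * conj (sphereFst p) ^ (b - s + j) *
        sphereSnd p ^ ((d - a - t) + (d - b - t) + ((N + d - i) + (N + d - j))))) =
      ∑ t ∈ Finset.range (d + 1), if i + a = j + b then 2 * Real.pi *
      ((orderCoeff a b s * ((i + a - s).factorial : ℤ) : ℤ) : ℂ) *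
      ((orderCoeff (d - a) (d - b) t * ((N + d - i + (d - a) - t).factorial : ℤ) : ℤ) : ℂ)
      else 0 := by
    intro s _
    rw [integral_finsetSum _ fun t _ => integrableOn_sphereDomain (by fun_prop)]
    refine Finset.sum_congr rfl fun t _ => ?_
    rw [integral_const_mul, orderCoeff_mul_integral ha hb hi hj]
  rw [Finset.sum_congr rfl this]
  have hN : (N.factorial : ℂ) ≠ 0 := by exact_mod_cast Nat.factorial_ne_zero _
  by_cases h : i + a = j + b
  · rw [← orderSum_mul_orderSum ha hb hi hj h]
    simp only [if_pos h, orderSum, Int.cast_mul, Int.cast_sum]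
    rw [mul_comm _ (N.factorial : ℂ), ← mul_assoc, div_mul_cancel₀ _ hN, Finset.sum_mul_sum,
      Finset.mul_sum]
    refine Finset.sum_congr rfl fun s _ => ?_
    rw [Finset.mul_sum]
    refine Finset.sum_congr rfl fun t _ => ?_
    ring
  · simp only [if_neg h, Finset.sum_const_zero]
    rw [Finset.sum_eq_zero, mul_zero]
    intro k _
    rw [if_neg (by omega)]

/-- The Toeplitz symbol of the kernel `(1 + |z|²)^N ∑ c a b z^a z̄^b`. -/
noncomputable def toeplitzSymbol (c : ℕ → ℕ → ℂ) (d N : ℕ) (p : ℝ × ℝ) : ℂ :=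
  ∑ a ∈ Finset.range (d + 1), ∑ b ∈ Finset.range (d + 1), c a b * toeplitzMonomial d N a b p

@[fun_prop]
theorem continuous_toeplitzSymbol (c : ℕ → ℕ → ℂ) (d N : ℕ) :
    Continuous (toeplitzSymbol c d N) := by
  unfold toeplitzSymbol
  fun_prop

theorem integral_toeplitzSymbol_monomial (c : ℕ → ℕ → ℂ) {d N i j : ℕ}
    (hi : i ≤ N + d) (hj : j ≤ N + d) :
    (∫ p in sphereDomain, toeplitzSymbol c d N p *
      ((sphereFst p ^ i * sphereSnd p ^ (N + d - i)) *
        conj (sphereFst p ^ j * sphereSnd p ^ (N + d - j)))) =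
      2 * Real.pi / N.factorial * (gramEntry c d N i j *
        (i.factorial * (N + d - i).factorial) * (j.factorial * (N + d - j).factorial)) := by
  simp_rw [toeplitzSymbol, Finset.sum_mul]
  rw [integral_finsetSum _ fun a _ => integrableOn_sphereDomain (by fun_prop)]
  simp only [gramEntry, Finset.sum_mul, Finset.mul_sum]
  refine Finset.sum_congr rfl fun a ha => ?_
  rw [integral_finsetSum _ fun b _ => integrableOn_sphereDomain (by fun_prop)]
  refine Finset.sum_congr rfl fun b hb => ?_
  simp_rw [mul_assoc (c a b)]
  rw [integral_const_mul, integral_toeplitzMonomial (Nat.lt_succ_iff.1 (Finset.mem_range.1 ha))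
    (Nat.lt_succ_iff.1 (Finset.mem_range.1 hb)) hi hj, Finset.mul_sum, Finset.mul_sum]
  refine Finset.sum_congr rfl fun k _ => ?_
  split_ifs
  · ring
  · simp

theorem integral_toeplitzSymbol (c : ℕ → ℕ → ℂ) (d N : ℕ) (w : ℕ → ℂ) :
    (∫ p in sphereDomain, toeplitzSymbol c d N p *
      ((‖∑ i ∈ Finset.range (N + d + 1),
        w i * (sphereFst p ^ i * sphereSnd p ^ (N + d - i))‖ ^ 2 : ℝ) : ℂ)) =
      2 * Real.pi / N.factorial * ∑ i ∈ Finset.range (N + d + 1), ∑ j ∈ Finset.range (N + d + 1),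
        (w i * (i.factorial * (N + d - i).factorial)) * gramEntry c d N i j *
        conj (w j * (j.factorial * (N + d - j).factorial)) := by
  have hexp : ∀ p, toeplitzSymbol c d N p *
      ((‖∑ i ∈ Finset.range (N + d + 1),
        w i * (sphereFst p ^ i * sphereSnd p ^ (N + d - i))‖ ^ 2 : ℝ) : ℂ) =
      ∑ i ∈ Finset.range (N + d + 1), ∑ j ∈ Finset.range (N + d + 1),
        (w i * conj (w j)) * (toeplitzSymbol c d N p *
      ((sphereFst p ^ i * sphereSnd p ^ (N + d - i)) *
        conj (sphereFst p ^ j * sphereSnd p ^ (N + d - j)))) := by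
    intro p
    rw [Complex.ofReal_pow, ← Complex.mul_conj', map_sum, Finset.sum_mul_sum, Finset.mul_sum]
    refine Finset.sum_congr rfl fun i _ => ?_
    rw [Finset.mul_sum]
    refine Finset.sum_congr rfl fun j _ => ?_
    rw [map_mul]
    ring
  simp_rw [hexp]
  rw [integral_finsetSum _ fun i _ => integrableOn_sphereDomain (by fun_prop), Finset.mul_sum]
  refine Finset.sum_congr rfl fun i hi => ?_
  rw [integral_finsetSum _ fun j _ => integrableOn_sphereDomain (by fun_prop), Finset.mul_sum]
  refine Finset.sum_congr rfl fun j hj => ?_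
  rw [integral_const_mul, integral_toeplitzSymbol_monomial c
    (Nat.lt_succ_iff.1 (Finset.mem_range.1 hi)) (Nat.lt_succ_iff.1 (Finset.mem_range.1 hj))]
  simp only [map_mul, Complex.conj_natCast]
  ring


/-! ### Positivity of the symbol for large `N`, and the resulting squared norm -/

/-- The value at `(z, z̄)` of the polynomial with coefficients `c a b`, `a, b ≤ d`. -/
def coeffVal (c : ℕ → ℕ → ℂ) (d : ℕ) (z : ℂ) : ℂ :=
  ∑ a ∈ Finset.range (d + 1), ∑ b ∈ Finset.range (d + 1), c a b * (z ^ a * conj z ^ b)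

/-- The bihomogenization of `coeffVal c d`, restricted to the sphere. -/
noncomputable def sphereVal (c : ℕ → ℕ → ℂ) (d : ℕ) (p : ℝ × ℝ) : ℂ :=
  ∑ a ∈ Finset.range (d + 1), ∑ b ∈ Finset.range (d + 1),
    c a b * (sphereFst p ^ a * conj (sphereFst p) ^ b * sphereSnd p ^ ((d - a) + (d - b)))

@[fun_prop]
theorem continuous_sphereVal (c : ℕ → ℕ → ℂ) (d : ℕ) : Continuous (sphereVal c d) := by
  unfold sphereVal
  fun_prop

theorem norm_sphere_monomial_le {p : ℝ × ℝ} (hp : p ∈ sphereDomain) (k l r : ℕ) :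
    ‖sphereFst p ^ k * conj (sphereFst p) ^ l * sphereSnd p ^ r‖ ≤ 1 := by
  rw [norm_mul, norm_mul, norm_pow, norm_pow, norm_pow, RCLike.norm_conj]
  have h1 := norm_sphereFst_le hp
  have h2 := norm_sphereSnd_le hp
  exact mul_le_one₀ (mul_le_one₀ (pow_le_one₀ (norm_nonneg _) h1) (by positivity)
    (pow_le_one₀ (norm_nonneg _) h1)) (by positivity) (pow_le_one₀ (norm_nonneg _) h2)

/-- The term `s = t = 0` is the main one. Every other term carries a factorial of at most `(N +
2d)!` and a monomial bounded by 1 on the sphere, so `K` does not depend on `N`. -/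
theorem exists_norm_toeplitzMonomial_sub_le (d a b : ℕ) :
    ∃ K : ℝ, ∀ (N : ℕ), ∀ p ∈ sphereDomain,
      ‖toeplitzMonomial d N a b p - ((N + d + d + 1).factorial : ℂ) *
        (sphereFst p ^ a * conj (sphereFst p) ^ b * sphereSnd p ^ ((d - a) + (d - b)))‖ ≤
      K * (N + d + d).factorial := by
  refine ⟨∑ s ∈ Finset.range (d + 1), ∑ t ∈ Finset.range (d + 1),
    ‖((orderCoeff a b s * orderCoeff (d - a) (d - b) t : ℤ) : ℂ)‖, fun N p hp => ?_⟩
  have hmain : ((N + d + d + 1).factorial : ℂ) *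
        (sphereFst p ^ a * conj (sphereFst p) ^ b * sphereSnd p ^ ((d - a) + (d - b))) =
      ∑ s ∈ Finset.range (d + 1), ∑ t ∈ Finset.range (d + 1), if s = 0 ∧ t = 0 then
        ((N + d + d + 1).factorial : ℂ) *
        (sphereFst p ^ a * conj (sphereFst p) ^ b * sphereSnd p ^ ((d - a) + (d - b))) else 0 := by
    simp [ite_and]
  rw [hmain, toeplitzMonomial, ← Finset.sum_sub_distrib, Finset.sum_mul]
  refine (norm_sum_le _ _).trans (Finset.sum_le_sum fun s _ => ?_)
  rw [← Finset.sum_sub_distrib, Finset.sum_mul]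
  refine (norm_sum_le _ _).trans (Finset.sum_le_sum fun t _ => ?_)
  by_cases h : s = 0 ∧ t = 0
  · obtain ⟨rfl, rfl⟩ := h
    simp only [orderCoeff]
    simp
  · rw [if_neg h, sub_zero, norm_mul, norm_mul, Complex.norm_natCast]
    have h1 : ((N + d + d + 1 - s - t).factorial : ℝ) ≤ (N + d + d).factorial := by
      exact_mod_cast Nat.factorial_le (by omega)
    calc _ ≤ ‖((orderCoeff a b s * orderCoeff (d - a) (d - b) t : ℤ) : ℂ)‖ *
          (N + d + d).factorial * 1 := by
          gcongr
          exact norm_sphere_monomial_le hp _ _ _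
      _ = _ := mul_one _

theorem exists_norm_toeplitzSymbol_sub_le (c : ℕ → ℕ → ℂ) (d : ℕ) :
    ∃ K : ℝ, ∀ (N : ℕ), ∀ p ∈ sphereDomain,
      ‖toeplitzSymbol c d N p - ((N + d + d + 1).factorial : ℂ) * sphereVal c d p‖ ≤
      K * (N + d + d).factorial := by
  choose K hK using exists_norm_toeplitzMonomial_sub_le d
  refine ⟨∑ a ∈ Finset.range (d + 1), ∑ b ∈ Finset.range (d + 1), ‖c a b‖ * K a b,
    fun N p hp => ?_⟩
  rw [toeplitzSymbol, sphereVal, Finset.mul_sum, ← Finset.sum_sub_distrib, Finset.sum_mul]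
  refine (norm_sum_le _ _).trans (Finset.sum_le_sum fun a _ => ?_)
  rw [Finset.mul_sum, ← Finset.sum_sub_distrib, Finset.sum_mul]
  refine (norm_sum_le _ _).trans (Finset.sum_le_sum fun b _ => ?_)
  rw [mul_left_comm, ← mul_sub, norm_mul, mul_assoc ‖c a b‖]
  exact mul_le_mul_of_nonneg_left (hK a b N p hp) (norm_nonneg (c a b))

theorem exists_toeplitzSymbol_nonneg {c : ℕ → ℕ → ℂ} {d : ℕ}
    (h : ∀ p ∈ sphereDomain, 0 < (sphereVal c d p).re) :
    ∃ N, ∀ p ∈ sphereDomain, 0 ≤ (toeplitzSymbol c d N p).re := by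
  obtain ⟨p₀, hp₀, hmin⟩ := isCompact_sphereDomain.exists_isMinOn
    (f := fun p => (sphereVal c d p).re) ⟨(0, 0), by simp [sphereDomain, Real.pi_pos.le]⟩
    (Complex.continuous_re.comp (continuous_sphereVal c d)).continuousOn
  set ε := (sphereVal c d p₀).re with hε
  have hε0 : 0 < ε := h p₀ hp₀
  obtain ⟨K, hK⟩ := exists_norm_toeplitzSymbol_sub_le c d
  -- `N ε ≥ K` suffices, since `(N + 2d + 1)! ε ≥ N ε (N + 2d)!` dominates the error.
  obtain ⟨N, hN⟩ := exists_nat_ge (K / ε)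
  refine ⟨N, fun p hp => ?_⟩
  have h1 := (Complex.abs_re_le_norm _).trans (hK N p hp)
  have h2 : ε ≤ (sphereVal c d p).re := hmin hp
  rw [Complex.sub_re, ← Complex.ofReal_natCast, Complex.re_ofReal_mul] at h1
  have h3 := (abs_le.1 h1).1
  rw [Nat.factorial_succ] at h3
  push_cast at h3
  have h4 : K ≤ N * ε := (div_le_iff₀ hε0).1 hN
  have hf : (0 : ℝ) < (N + d + d).factorial := by positivity
  have h5 : (N + d + d).factorial * ((N : ℝ) * ε) ≤
      ((N : ℝ) + d + d + 1) * (N + d + d).factorial * (sphereVal c d p).re := by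
    have : (N : ℝ) * ε ≤ ((N : ℝ) + d + d + 1) * (sphereVal c d p).re := by
      gcongr
      have : (0 : ℝ) ≤ d := by positivity
      linarith
    nlinarith
  nlinarith

theorem re_gramEntry_form_nonneg {c : ℕ → ℕ → ℂ} {d N : ℕ}
    (h : ∀ p ∈ sphereDomain, 0 ≤ (toeplitzSymbol c d N p).re) (v : ℕ → ℂ) :
    0 ≤ (∑ i ∈ Finset.range (N + d + 1), ∑ j ∈ Finset.range (N + d + 1),
      v i * gramEntry c d N i j * conj (v j)).re := by
  have hne : ∀ i : ℕ, (i.factorial * (N + d - i).factorial : ℂ) ≠ 0 := fun i => by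
    exact_mod_cast mul_ne_zero (Nat.factorial_ne_zero _) (Nat.factorial_ne_zero _)
  -- Dividing the test vector by the factorial weights undoes the diagonal scaling of the matrix.
  have key := integral_toeplitzSymbol c d N
    (fun i => v i / (i.factorial * (N + d - i).factorial : ℂ))
  simp only [div_mul_cancel₀ _ (hne _)] at key
  have hre := congrArg Complex.re key
  have e : (2 * Real.pi / N.factorial : ℂ) = ((2 * Real.pi / N.factorial : ℝ) : ℂ) := by
    push_cast; rfl
  rw [e, Complex.re_ofReal_mul, ← Complex.reCLM_apply, ← ContinuousLinearMap.integral_comp_comm _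
    (integrableOn_sphereDomain (by fun_prop))] at hre
  have hpos : 0 ≤ 2 * Real.pi / N.factorial * (∑ i ∈ Finset.range (N + d + 1),
      ∑ j ∈ Finset.range (N + d + 1), v i * gramEntry c d N i j * conj (v j)).re := by
    rw [← hre]
    refine setIntegral_nonneg isCompact_sphereDomain.measurableSet fun p hp => ?_
    rw [Complex.reCLM_apply, Complex.re_mul_ofReal]
    exact mul_nonneg (h p hp) (by positivity)
  exact nonneg_of_mul_nonneg_right hpos (by positivity)

theorem conj_gramEntry {c : ℕ → ℕ → ℂ} (hc : ∀ a b, conj (c a b) = c b a) (d N i j : ℕ) :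
    conj (gramEntry c d N j i) = gramEntry c d N i j := by
  simp only [gramEntry, map_sum]
  rw [Finset.sum_comm]
  refine Finset.sum_congr rfl fun a _ => Finset.sum_congr rfl fun b _ =>
    Finset.sum_congr rfl fun k _ => ?_
  rw [apply_ite conj, map_mul, hc, map_zero, Complex.conj_natCast]
  simp only [and_comm]

theorem sum_gramEntry (c : ℕ → ℕ → ℂ) (d N : ℕ) (z : ℂ) :
    ∑ i ∈ Finset.range (N + d + 1), ∑ j ∈ Finset.range (N + d + 1),
      gramEntry c d N i j * (conj z ^ i * z ^ j) =
    (1 + z * conj z) ^ N * coeffVal c d z := by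
  simp only [gramEntry, coeffVal, Finset.sum_mul, Finset.mul_sum]
  have h1 : ∀ i, ∑ j ∈ Finset.range (N + d + 1), ∑ a ∈ Finset.range (d + 1),
      ∑ b ∈ Finset.range (d + 1), ∑ k ∈ Finset.range (N + 1),
      (if i = b + k ∧ j = a + k then c a b * N.choose k else 0) * (conj z ^ i * z ^ j) =
      ∑ a ∈ Finset.range (d + 1), ∑ b ∈ Finset.range (d + 1), ∑ k ∈ Finset.range (N + 1),
        ∑ j ∈ Finset.range (N + d + 1),
        (if i = b + k ∧ j = a + k then c a b * N.choose k else 0) * (conj z ^ i * z ^ j) := by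
    intro i
    rw [Finset.sum_comm]
    refine Finset.sum_congr rfl fun a _ => ?_
    rw [Finset.sum_comm]
    refine Finset.sum_congr rfl fun b _ => ?_
    rw [Finset.sum_comm]
  simp_rw [h1]
  rw [Finset.sum_comm]
  refine Finset.sum_congr rfl fun a ha => ?_
  rw [Finset.sum_comm]
  refine Finset.sum_congr rfl fun b hb => ?_
  rw [Finset.sum_comm, add_comm (1 : ℂ), add_pow, Finset.sum_mul]
  refine Finset.sum_congr rfl fun k hk => ?_
  simp only [Finset.mem_range] at ha hb hk
  rw [Finset.sum_eq_single (b + k), Finset.sum_eq_single (a + k)]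
  · simp only [and_self, if_true, one_pow, mul_one, pow_add, mul_pow]; ring
  · intro j _ hj; simp [hj]
  · intro hn; exact absurd (Finset.mem_range.2 (by omega)) hn
  · intro i _ hi; simp [hi]
  · intro hn; exact absurd (Finset.mem_range.2 (by omega)) hn

open scoped ComplexOrder in
theorem exists_sqNorm_of_sphereVal_pos {c : ℕ → ℕ → ℂ} {d : ℕ}
    (hc : ∀ a b, conj (c a b) = c b a) (h : ∀ p ∈ sphereDomain, 0 < (sphereVal c d p).re) :
    ∃ (N m : ℕ) (F : Fin m → Polynomial ℂ), ∀ z : ℂ,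
      (1 + z * conj z) ^ N * coeffVal c d z = (sqNorm F z : ℂ) := by
  obtain ⟨N, hN⟩ := exists_toeplitzSymbol_nonneg h
  let A : Matrix (Fin (N + d + 1)) (Fin (N + d + 1)) ℂ := fun i j => gramEntry c d N i j
  have hA : A.IsHermitian := by
    ext i j
    exact conj_gramEntry hc d N i j
  have hpsd : A.PosSemidef := by
    refine Matrix.PosSemidef.of_dotProduct_mulVec_nonneg hA fun x => ?_
    rw [Complex.le_def]
    refine ⟨?_, (hA.im_star_dotProduct_mulVec_self x).symm⟩
    let v : ℕ → ℂ := fun i => if hi : i < N + d + 1 then conj (x ⟨i, hi⟩) else 0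
    have hv : ∀ i : Fin (N + d + 1), v i = conj (x i) := fun i => dif_pos i.isLt
    have := re_gramEntry_form_nonneg hN v
    simp only [Finset.sum_range, hv, Complex.conj_conj] at this
    refine this.trans_eq (congrArg Complex.re ?_)
    simp only [dotProduct, Matrix.mulVec, Finset.mul_sum]
    refine Finset.sum_congr rfl fun i _ => Finset.sum_congr rfl fun j _ => ?_
    simp only [Pi.star_apply, RCLike.star_def, A]
    ring
  obtain ⟨m, v, hv⟩ := Matrix.posSemidef_iff_eq_sum_vecMulVec.1 hpsd
  -- The coefficients are conjugated because `gramEntry` has its row index on `z̄` and its column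
  -- index on `z`.
  refine ⟨N, m, fun l => ∑ i : Fin (N + d + 1), Polynomial.monomial (i : ℕ) (conj (v l i)), fun z => ?_⟩
  have hAv : ∀ i j : Fin (N + d + 1), gramEntry c d N i j = ∑ l, v l i * conj (v l j) := by
    intro i j
    have := congrFun (congrFun hv i) j
    simpa [A, Matrix.sum_apply, Matrix.vecMulVec_apply] using this
  rw [← sum_gramEntry, sqNorm]
  simp only [Finset.sum_range, hAv, Complex.ofReal_sum, Complex.ofReal_pow, ← Complex.conj_mul']
  simp only [Polynomial.eval_finsetSum, Polynomial.eval_monomial, map_sum, map_mul, map_pow,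
    Complex.conj_conj, Finset.sum_mul]
  rw [Finset.sum_comm_cycle]
  refine Finset.sum_congr rfl fun l _ => Finset.sum_congr rfl fun i _ => ?_
  rw [Finset.mul_sum]
  refine Finset.sum_congr rfl fun j _ => ?_
  ring

theorem sphereVal_eq {c : ℕ → ℕ → ℂ} {d : ℕ} {p : ℝ × ℝ} (hp : sphereSnd p ≠ 0) :
    sphereVal c d p = ((√(1 - p.1) ^ (2 * d) : ℝ) : ℂ) *
      coeffVal c d (sphereFst p / sphereSnd p) := by
  rw [sphereVal, coeffVal, Finset.mul_sum]
  refine Finset.sum_congr rfl fun a ha => ?_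
  rw [Finset.mul_sum]
  refine Finset.sum_congr rfl fun b hb => ?_
  simp only [Finset.mem_range] at ha hb
  have e : ((√(1 - p.1) ^ (2 * d) : ℝ) : ℂ) =
      sphereSnd p ^ ((d - a) + (d - b)) * sphereSnd p ^ a * sphereSnd p ^ b := by
    rw [← pow_add, ← pow_add, show d - a + (d - b) + a + b = 2 * d by omega, sphereSnd]
    push_cast; rfl
  rw [e, map_div₀, conj_sphereSnd, div_pow, div_pow]
  field_simp

theorem sphereVal_eq_of_fst_eq_one {c : ℕ → ℕ → ℂ} {d : ℕ} {p : ℝ × ℝ} (hp : p.1 = 1) :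
    sphereVal c d p = c d d := by
  have h0 : sphereSnd p = 0 := by simp [sphereSnd, hp]
  have h1 : sphereFst p * conj (sphereFst p) = 1 := by
    rw [Complex.mul_conj', norm_sphereFst, hp]; simp
  rw [sphereVal, Finset.sum_eq_single d, Finset.sum_eq_single d]
  · simp [← mul_pow, h1]
  · intro b hb hne
    have := Finset.mem_range.1 hb
    rw [h0, zero_pow (by omega)]; simp
  · simp
  · intro a ha hne
    have := Finset.mem_range.1 ha
    refine Finset.sum_eq_zero fun b _ => ?_
    rw [h0, zero_pow (by omega)]; simp
  · simp

/-- Away from `p.1 = 1` the sphere value is a positive multiple of an affine value. On the circle at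
infinity it equals `c d d`, which is real, nonnegative by continuity, and nonzero by hypothesis. -/
theorem sphereVal_pos {c : ℕ → ℕ → ℂ} {d : ℕ} (hc : ∀ a b, conj (c a b) = c b a)
    (hdd : c d d ≠ 0) (h : ∀ z, 0 < (coeffVal c d z).re) (p : ℝ × ℝ) (hp : p ∈ sphereDomain) :
    0 < (sphereVal c d p).re := by
  have hlt : ∀ q : ℝ × ℝ, q.1 < 1 → 0 < (sphereVal c d q).re := by
    intro q hq
    have hs : 0 < √(1 - q.1) := Real.sqrt_pos.2 (by linarith)
    rw [sphereVal_eq (by simpa [sphereSnd] using hs.ne'), Complex.re_ofReal_mul]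
    exact mul_pos (by positivity) (h _)
  rcases lt_or_eq_of_le hp.1.2 with h1 | h1
  · exact hlt p h1
  · rw [sphereVal_eq_of_fst_eq_one h1]
    have hcont : Continuous fun x : ℝ => (sphereVal c d (x, 0)).re := by fun_prop
    have hge : 0 ≤ (sphereVal c d (1, 0)).re := by
      refine ge_of_tendsto (hcont.continuousWithinAt (s := Set.Iio 1) (x := 1)) ?_
      filter_upwards [self_mem_nhdsWithin] with x hx
      exact (hlt (x, 0) hx).le
    rw [sphereVal_eq_of_fst_eq_one rfl] at hge
    refine lt_of_le_of_ne hge fun h0 => hdd ?_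
    exact Complex.ext h0.symm (Complex.conj_eq_iff_im.1 (hc d d))

/-- A strictly positive Hermitian polynomial of degree `d` in `z` with a nonzero coefficient of
`|z|^(2d)` becomes a squared norm after multiplication by a power of `1 + |z|²`. -/
theorem exists_sqNorm_of_pos {c : ℕ → ℕ → ℂ} {d : ℕ} (hc : ∀ a b, conj (c a b) = c b a)
    (hdd : c d d ≠ 0) (h : ∀ z, 0 < (coeffVal c d z).re) :
    ∃ (N m : ℕ) (F : Fin m → Polynomial ℂ), ∀ z : ℂ,
      (1 + z * conj z) ^ N * coeffVal c d z = (sqNorm F z : ℂ) :=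
  exists_sqNorm_of_sphereVal_pos hc (sphereVal_pos hc hdd h)

/-! ### Hermitian polynomials: coefficients, conjugation, polarization -/

open MvPolynomial (X C)

/-- The exponent of `z^a z̄^b`. -/
noncomputable def biExp (a b : ℕ) : Fin 2 →₀ ℕ := Finsupp.single 0 a + Finsupp.single 1 b

@[simp] theorem biExp_zero (a b : ℕ) : biExp a b 0 = a := by simp [biExp]

@[simp] theorem biExp_one (a b : ℕ) : biExp a b 1 = b := by simp [biExp]

theorem biExp_eta (m : Fin 2 →₀ ℕ) : biExp (m 0) (m 1) = m := by
  ext i; fin_cases i <;> simp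

theorem biExp_inj {a b a' b' : ℕ} : biExp a b = biExp a' b' ↔ a = a' ∧ b = b' := by
  refine ⟨fun h => ⟨?_, ?_⟩, fun ⟨h, h'⟩ => by rw [h, h']⟩
  · simpa using DFunLike.congr_fun h 0
  · simpa using DFunLike.congr_fun h 1

theorem sum_biExp (a b : ℕ) : ((biExp a b).sum fun _ e => e) = a + b := by
  rw [Finsupp.sum_fintype _ _ (by simp), Fin.sum_univ_two]; simp

theorem eval_eq_sum_coeff {r : BiPoly} {d : ℕ} (h0 : r.degreeOf 0 ≤ d) (h1 : r.degreeOf 1 ≤ d)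
    (z w : ℂ) :
    MvPolynomial.eval ![z, w] r = ∑ a ∈ Finset.range (d + 1), ∑ b ∈ Finset.range (d + 1),
      MvPolynomial.coeff (biExp a b) r * (z ^ a * w ^ b) := by
  rw [MvPolynomial.eval_eq', ← Finset.sum_product']
  refine Finset.sum_of_injOn (fun m => (m 0, m 1)) ?_ ?_ ?_ ?_
  · intro m _ m' _ h
    simp only [Prod.mk.injEq] at h
    rw [← biExp_eta m, ← biExp_eta m', h.1, h.2]
  · intro m hm
    have := MvPolynomial.degreeOf_le_iff.1 h0 m hm
    have := MvPolynomial.degreeOf_le_iff.1 h1 m hm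
    simp only [Finset.coe_product, Finset.coe_range, Set.mem_prod, Set.mem_Iio]
    omega
  · rintro ⟨a, b⟩ _ h
    have : biExp a b ∉ r.support := fun hmem => h ⟨biExp a b, hmem, by simp⟩
    rw [MvPolynomial.notMem_support_iff.1 this, zero_mul]
  · intro m _
    simp [biExp_eta, Fin.prod_univ_two]

/-- The involution `r(z, w̄) ↦ conj (r(w, z̄))` on polynomials. -/
noncomputable def hermConj : BiPoly →+* BiPoly :=
  (MvPolynomial.rename (Equiv.swap (0 : Fin 2) 1)).toRingHom.comp
    (MvPolynomial.map (starRingEnd ℂ))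

theorem hermConj_apply (r : BiPoly) : hermConj r =
    MvPolynomial.rename (Equiv.swap (0 : Fin 2) 1) (MvPolynomial.map (starRingEnd ℂ) r) := rfl

theorem pol_hermConj (r : BiPoly) (z w : ℂ) : pol (hermConj r) z w = conj (pol r w z) := by
  rw [hermConj_apply, pol, pol, MvPolynomial.eval_rename, MvPolynomial.eval_map,
    ← MvPolynomial.coe_eval₂Hom]
  have : (starRingEnd ℂ) (MvPolynomial.eval ![w, conj z] r) =
      ((starRingEnd ℂ).comp (MvPolynomial.eval ![w, conj z])) r := rfl
  rw [this]
  congr 1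
  refine MvPolynomial.ringHom_ext (fun x => by simp) fun i => ?_
  fin_cases i <;> simp

theorem coeff_hermConj (r : BiPoly) (a b : ℕ) :
    MvPolynomial.coeff (biExp a b) (hermConj r) = conj (MvPolynomial.coeff (biExp b a) r) := by
  have h : biExp a b = (biExp b a).mapDomain (Equiv.swap (0 : Fin 2) 1) := by
    simp [biExp, Finsupp.mapDomain_add, Finsupp.mapDomain_single, add_comm]
  rw [hermConj_apply, h, MvPolynomial.coeff_rename_mapDomain _ (Equiv.injective _),
    MvPolynomial.coeff_map]

theorem eq_of_pol_eq {r s : BiPoly} (h : ∀ z w, pol r z w = pol s z w) : r = s := by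
  refine MvPolynomial.funext fun x => ?_
  have := h (x 0) (conj (x 1))
  rw [pol, pol, Complex.conj_conj] at this
  have hx : ![x 0, x 1] = x := by ext i; fin_cases i <;> rfl
  rwa [hx] at this

theorem isHermitianSymm_iff {r : BiPoly} : IsHermitianSymm r ↔ hermConj r = r := by
  constructor
  · intro h
    exact eq_of_pol_eq fun z w => by rw [pol_hermConj, h z w]
  · intro h z w
    rw [← pol_hermConj, h]

@[simp] theorem pol_mul (r s : BiPoly) (z w : ℂ) : pol (r * s) z w = pol r z w * pol s z w := by
  simp [pol]

@[simp] theorem pol_sub (r s : BiPoly) (z w : ℂ) : pol (r - s) z w = pol r z w - pol s z w := by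
  simp [pol]

@[simp] theorem val_mul (r s : BiPoly) (z : ℂ) : val (r * s) z = val r z * val s z := pol_mul ..

@[simp] theorem val_sub (r s : BiPoly) (z : ℂ) : val (r - s) z = val r z - val s z := pol_sub ..

theorem IsHermitianSymm.mul {r s : BiPoly} (hr : IsHermitianSymm r) (hs : IsHermitianSymm s) :
    IsHermitianSymm (r * s) := by
  rw [isHermitianSymm_iff] at *
  rw [map_mul, hr, hs]

/-- A polynomial is determined by its values on the diagonal `w = z`. -/
theorem eq_of_val_eq {r s : BiPoly} (h : ∀ z, val r z = val s z) : r = s := by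
  let φ : BiPoly →ₐ[ℂ] BiPoly := MvPolynomial.aeval ![X 0 + C Complex.I * X 1,
    X 0 - C Complex.I * X 1]
  have hφ : ∀ (t : BiPoly) (x : Fin 2 → ℂ), MvPolynomial.eval x (φ t) =
      MvPolynomial.eval ![x 0 + Complex.I * x 1, x 0 - Complex.I * x 1] t := by
    intro t x
    have : (MvPolynomial.eval x).comp φ.toRingHom =
        MvPolynomial.eval ![x 0 + Complex.I * x 1, x 0 - Complex.I * x 1] := by
      refine MvPolynomial.ringHom_ext (fun c => by simp [φ]) fun i => ?_
      fin_cases i <;> simp [φ]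
    exact RingHom.congr_fun this t
  have hinf : (Set.range ((↑) : ℝ → ℂ)).Infinite :=
    Set.infinite_range_of_injective Complex.ofReal_injective
  have key : φ r = φ s := by
    -- In the coordinates `z = x + iy`, `z̄ = x - iy`, the diagonal becomes the real points, and
    -- agreement on `ℝ × ℝ` determines a polynomial.
    refine MvPolynomial.funext_set (fun _ => Set.range ((↑) : ℝ → ℂ)) (fun _ => hinf) fun x hx => ?_
    obtain ⟨a, ha⟩ := hx 0 trivial
    obtain ⟨b, hb⟩ := hx 1 trivial
    have := h (a + Complex.I * b)
    have e : conj ((a : ℂ) + Complex.I * b) = a - Complex.I * b := by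
      simp [sub_eq_add_neg]
    rw [val, val, pol, pol, e] at this
    rw [hφ, hφ, ← ha, ← hb, this]
  refine MvPolynomial.funext fun y => ?_
  have := congrArg (MvPolynomial.eval ![(y 0 + y 1) / 2, (y 0 - y 1) / (2 * Complex.I)]) key
  have hy : ![(y 0 + y 1) / 2 + Complex.I * ((y 0 - y 1) / (2 * Complex.I)),
      (y 0 + y 1) / 2 - Complex.I * ((y 0 - y 1) / (2 * Complex.I))] = y := by
    ext i
    fin_cases i <;> simp <;> field_simp <;> ring
  rw [hφ, hφ] at this
  simpa only [Matrix.cons_val_zero, Matrix.cons_val_one, hy] using this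

/-- A polynomial in `z`, viewed as a polynomial in `z` and `z̄`. -/
noncomputable def holo : Polynomial ℂ →ₐ[ℂ] BiPoly := Polynomial.aeval (X 0)

@[simp] theorem pol_holo (f : Polynomial ℂ) (z w : ℂ) : pol (holo f) z w = f.eval z := by
  rw [pol, holo, Polynomial.aeval_def, Polynomial.hom_eval₂, Polynomial.eval]
  congr 1
  · ext; simp
  · simp

/-! ### Squared norms as polynomials -/

/-- The squared norm of a holomorphic polynomial mapping, as a polynomial in `z` and `z̄`. -/
noncomputable def sqPoly {N : ℕ} (F : Fin N → Polynomial ℂ) : BiPoly :=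
  ∑ j, holo (F j) * hermConj (holo (F j))

theorem pol_sqPoly {N : ℕ} (F : Fin N → Polynomial ℂ) (z w : ℂ) :
    pol (sqPoly F) z w = ∑ j, (F j).eval z * conj ((F j).eval w) := by
  rw [pol, sqPoly, map_sum]
  refine Finset.sum_congr rfl fun j _ => ?_
  have := pol_mul (holo (F j)) (hermConj (holo (F j))) z w
  rwa [pol_hermConj, pol_holo, pol_holo] at this

@[simp] theorem val_sqPoly {N : ℕ} (F : Fin N → Polynomial ℂ) (z : ℂ) :
    val (sqPoly F) z = (sqNorm F z : ℂ) := by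
  rw [val, pol_sqPoly, sqNorm]
  push_cast
  exact Finset.sum_congr rfl fun j _ => Complex.mul_conj' _

theorem isHermitianSymm_sqPoly {N : ℕ} (F : Fin N → Polynomial ℂ) :
    IsHermitianSymm (sqPoly F) := by
  intro z w
  rw [pol_sqPoly, pol_sqPoly, map_sum]
  refine Finset.sum_congr rfl fun j _ => ?_
  rw [map_mul, Complex.conj_conj, mul_comm]

theorem mem_PInfty_iff {r : BiPoly} :
    r ∈ PInfty ↔ ∃ (N : ℕ) (F : Fin N → Polynomial ℂ), r = sqPoly F := by
  constructor
  · rintro ⟨-, N, F, h⟩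
    exact ⟨N, F, eq_of_val_eq fun z => by rw [h, val_sqPoly]⟩
  · rintro ⟨N, F, rfl⟩
    exact ⟨isHermitianSymm_sqPoly F, N, F, val_sqPoly F⟩

theorem coeff_holo_mul_hermConj (f : Polynomial ℂ) (a b : ℕ) :
    MvPolynomial.coeff (biExp a b) (holo f * hermConj (holo f)) =
      f.coeff a * conj (f.coeff b) := by
  have h1 : holo f = ∑ n ∈ Finset.range (f.natDegree + 1), C (f.coeff n) * X 0 ^ n := by
    conv_lhs => rw [f.as_sum_range_C_mul_X_pow]
    simp [holo, MvPolynomial.algebraMap_eq]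
  have h2 : hermConj (holo f) =
      ∑ n ∈ Finset.range (f.natDegree + 1), C (conj (f.coeff n)) * X 1 ^ n := by
    rw [h1]
    simp [hermConj_apply]
  have h3 : holo f * hermConj (holo f) = ∑ n ∈ Finset.range (f.natDegree + 1),
      ∑ k ∈ Finset.range (f.natDegree + 1),
        MvPolynomial.monomial (biExp n k) (f.coeff n * conj (f.coeff k)) := by
    rw [h2, h1, Finset.sum_mul_sum]
    refine Finset.sum_congr rfl fun n _ => Finset.sum_congr rfl fun k _ => ?_
    rw [MvPolynomial.C_mul_X_pow_eq_monomial, MvPolynomial.C_mul_X_pow_eq_monomial,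
      MvPolynomial.monomial_mul, biExp]
  have h4 : ∀ n, n ∉ Finset.range (f.natDegree + 1) → f.coeff n = 0 := fun n hn =>
    Polynomial.coeff_eq_zero_of_natDegree_lt (by simpa using hn)
  rw [h3, MvPolynomial.coeff_sum, Finset.sum_eq_single a, MvPolynomial.coeff_sum,
    Finset.sum_eq_single b, MvPolynomial.coeff_monomial, if_pos rfl]
  · intro k _ hk
    rw [MvPolynomial.coeff_monomial, if_neg (by simp [biExp_inj, hk])]
  · intro hb
    simp [h4 b hb]
  · intro n _ hn
    rw [MvPolynomial.coeff_sum]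
    refine Finset.sum_eq_zero fun k _ => ?_
    rw [MvPolynomial.coeff_monomial, if_neg (by simp [biExp_inj, hn])]
  · intro ha
    simp [h4 a ha]

theorem coeff_sqPoly {N : ℕ} (F : Fin N → Polynomial ℂ) (a b : ℕ) :
    MvPolynomial.coeff (biExp a b) (sqPoly F) = ∑ j, (F j).coeff a * conj ((F j).coeff b) := by
  rw [sqPoly, MvPolynomial.coeff_sum]
  exact Finset.sum_congr rfl fun j _ => coeff_holo_mul_hermConj _ _ _

theorem totalDegree_sqPoly {N : ℕ} {F : Fin N → Polynomial ℂ} (h : sqPoly F ≠ 0) :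
    (sqPoly F).totalDegree = 2 * (sqPoly F).degreeOf 0 := by
  classical
  have hex : ∃ j, F j ≠ 0 := by
    by_contra! hF
    exact h (by simp [sqPoly, hF])
  obtain ⟨j₀, hj₀, hmax⟩ := Finset.exists_max_image (Finset.univ.filter fun j => F j ≠ 0)
    (fun j => (F j).natDegree) (by obtain ⟨j, hj⟩ := hex; exact ⟨j, by simpa using hj⟩)
  set m := (F j₀).natDegree with hm
  have hcoeff : ∀ n, m < n → ∀ j, (F j).coeff n = 0 := by
    intro n hn j
    by_cases hj : F j = 0
    · simp [hj]
    · exact Polynomial.coeff_eq_zero_of_natDegree_lt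
        ((hmax j (by simpa using hj)).trans_lt hn)
  have hsupp : ∀ e ∈ (sqPoly F).support, e 0 ≤ m ∧ e 1 ≤ m := by
    intro e he
    rw [MvPolynomial.mem_support_iff, ← biExp_eta e, coeff_sqPoly] at he
    constructor <;>
    · by_contra! hlt
      exact he (by simp [hcoeff _ hlt])
  -- No cancellation occurs on the diagonal: the coefficient is a sum of `|(F j).coeff m|²`,
  -- positive at `j₀`.
  have hmm : biExp m m ∈ (sqPoly F).support := by
    rw [MvPolynomial.mem_support_iff, coeff_sqPoly]
    simp_rw [Complex.mul_conj', ← Complex.ofReal_pow, ← Complex.ofReal_sum]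
    rw [Complex.ofReal_ne_zero]
    refine (Finset.sum_pos' (fun j _ => by positivity) ⟨j₀, Finset.mem_univ _, ?_⟩).ne'
    have : (F j₀).coeff m ≠ 0 := by
      rw [hm]
      exact Polynomial.leadingCoeff_ne_zero.2 (by simpa using hj₀)
    positivity
  have hdeg : (sqPoly F).degreeOf 0 = m := by
    refine le_antisymm (MvPolynomial.degreeOf_le_iff.2 fun e he => (hsupp e he).1) ?_
    simpa using MvPolynomial.monomial_le_degreeOf 0 hmm
  rw [hdeg]
  refine le_antisymm (Finset.sup_le fun e he => ?_) ?_
  · have := hsupp e he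
    rw [← biExp_eta e, sum_biExp]
    omega
  · have := MvPolynomial.le_totalDegree hmm
    rw [sum_biExp] at this
    omega

/-! ### Splitting off the factors `|z - p|²` -/

theorem prime_X_zero_sub_C (p : ℂ) : Prime (X 0 - C p : BiPoly) := by
  rw [← MulEquiv.prime_iff (MvPolynomial.finSuccEquiv ℂ 1)]
  have : MvPolynomial.finSuccEquiv ℂ 1 (X 0 - C p) = Polynomial.X - Polynomial.C (C p) := by
    rw [map_sub, MvPolynomial.finSuccEquiv_X_zero]
    simp [MvPolynomial.finSuccEquiv_apply]
  rw [this]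
  exact Polynomial.prime_X_sub_C _

theorem absSqSub_eq (p : ℂ) : absSqSub p = (X 0 - C p) * hermConj (X 0 - C p) := by
  simp [absSqSub, hermConj_apply]

@[simp] theorem val_absSqSub (p z : ℂ) : val (absSqSub p) z = (z - p) * conj (z - p) := by
  simp [val, pol, absSqSub]

theorem absSqSub_ne_zero (p : ℂ) : absSqSub p ≠ 0 := by
  intro h
  have := val_absSqSub p (p + 1)
  rw [h] at this
  simp [val, pol] at this

theorem totalDegree_absSqSub_pos (p : ℂ) : 0 < (absSqSub p).totalDegree := by
  rw [Nat.pos_iff_ne_zero]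
  intro h
  have hC := MvPolynomial.totalDegree_eq_zero_iff_eq_C.1 h
  have h0 := val_absSqSub p p
  have h1 := val_absSqSub p (p + 1)
  rw [hC] at h0 h1
  simp [val, pol] at h0 h1
  simp [h0] at h1

theorem absSqSub_dvd {r : BiPoly} (hr : IsHermitianSymm r) {p : ℂ} (h : X 0 - C p ∣ r) :
    absSqSub p ∣ r := by
  obtain ⟨r₁, rfl⟩ := h
  have hr' := isHermitianSymm_iff.1 hr
  have hd : (X 0 - C p : BiPoly) ∣ hermConj (X 0 - C p) * hermConj r₁ := by
    rw [← map_mul, hr']; exact dvd_mul_right _ _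
  rcases (prime_X_zero_sub_C p).dvd_or_dvd hd with ⟨t, ht⟩ | ⟨t, ht⟩
  -- `z - p` cannot divide its conjugate factor: at `z = p`, `w = p + 1` the former is 0 and the
  -- latter is 1.
  · have := congrArg (fun q => pol q p (p + 1)) ht
    simp only [pol_mul, pol_hermConj] at this
    simp [pol] at this
  · refine ⟨t, ?_⟩
    rw [← hr', map_mul, ht, absSqSub_eq]
    ring

theorem sqPoly_X_sub_C_mul {N : ℕ} (F : Fin N → Polynomial ℂ) (p : ℂ) :
    sqPoly (fun j => (Polynomial.X - Polynomial.C p) * F j) = absSqSub p * sqPoly F := by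
  have h : holo (Polynomial.X - Polynomial.C p) = X 0 - C p := by
    simp [holo, MvPolynomial.algebraMap_eq]
  rw [sqPoly, sqPoly, Finset.mul_sum]
  refine Finset.sum_congr rfl fun j _ => ?_
  rw [map_mul, map_mul, h, absSqSub_eq]
  ring

theorem exists_eq_absSqSub_mul_sqPoly {N : ℕ} {F : Fin N → Polynomial ℂ} {p : ℂ}
    (h : sqNorm F p = 0) : ∃ F' : Fin N → Polynomial ℂ, sqPoly F = absSqSub p * sqPoly F' := by
  have hF : ∀ j, (F j).eval p = 0 := by
    intro j
    have := (Finset.sum_eq_zero_iff_of_nonneg fun j _ => by positivity).1 h j (Finset.mem_univ j)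
    simpa using this
  choose F' hF' using fun j => Polynomial.dvd_iff_isRoot.2 (hF j)
  refine ⟨F', ?_⟩
  rw [← sqPoly_X_sub_C_mul]
  exact congrArg sqPoly (funext hF')

theorem sqNorm_nonneg {N : ℕ} (F : Fin N → Polynomial ℂ) (z : ℂ) : 0 ≤ sqNorm F z :=
  Finset.sum_nonneg fun _ _ => by positivity

theorem isHermitianSymm_of_mul_sqPoly {r : BiPoly} {M N : ℕ} {F : Fin N → Polynomial ℂ}
    {G : Fin M → Polynomial ℂ} (h : r * sqPoly G = sqPoly F) (hG : sqPoly G ≠ 0) :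
    IsHermitianSymm r := by
  rw [isHermitianSymm_iff]
  refine mul_right_cancel₀ hG ?_
  have hF := isHermitianSymm_iff.1 (isHermitianSymm_sqPoly F)
  have hG := isHermitianSymm_iff.1 (isHermitianSymm_sqPoly G)
  rw [h, ← hF, ← h, map_mul, hG]

/-- A nonzero quotient of squared norms splits off the factors `|z - p|²` at its zeros, leaving a
strictly positive polynomial whose total degree is twice its degree in `z`. -/
theorem exists_factorization {r : BiPoly} {M N : ℕ} {F : Fin N → Polynomial ℂ}
    {G : Fin M → Polynomial ℂ} (h : r * sqPoly G = sqPoly F) (hF : sqPoly F ≠ 0) :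
    ∃ (K : ℕ) (p : Fin K → ℂ) (s : BiPoly),
        {z : ℂ | val r z = 0} = Set.range p ∧
        r = (∏ j, absSqSub (p j)) * s ∧
        IsStrictlyPositive s ∧
        MvPolynomial.totalDegree s = 2 * MvPolynomial.degreeOf 0 s := by
  induction hn : (sqPoly F).totalDegree using Nat.strong_induction_on generalizing r F G with
  | _ n ih =>
  subst hn
  have hr0 : r ≠ 0 := by rintro rfl; exact hF (by rw [← h, zero_mul])
  have hG0 : sqPoly G ≠ 0 := by intro hG; exact hF (by rw [← h, hG, mul_zero])
  have hr := isHermitianSymm_of_mul_sqPoly h hG0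
  have hval : ∀ z, val r z * (sqNorm G z : ℂ) = (sqNorm F z : ℂ) := fun z => by
    rw [← val_sqPoly, ← val_sqPoly, ← val_mul, h]
  by_cases hz : ∃ p, sqNorm F p = 0
  · obtain ⟨p, hp⟩ := hz
    obtain ⟨F', hF'⟩ := exists_eq_absSqSub_mul_sqPoly hp
    have hF'0 : sqPoly F' ≠ 0 := by intro h0; exact hF (by rw [hF', h0, mul_zero])
    have hdeg : (sqPoly F').totalDegree < (sqPoly F).totalDegree := by
      rw [hF', MvPolynomial.totalDegree_mul_of_isDomain (absSqSub_ne_zero p) hF'0]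
      have := totalDegree_absSqSub_pos p
      omega
    by_cases hGp : sqNorm G p = 0
    · obtain ⟨G', hG'⟩ := exists_eq_absSqSub_mul_sqPoly hGp
      refine ih _ hdeg (G := G') (mul_left_cancel₀ (absSqSub_ne_zero p) ?_) hF'0 rfl
      rw [← hF', ← h, hG']
      ring
    -- As `z - p` would force `G` to vanish at `p`, primality sends it into `r`; `F'` is then
    -- handled with the same `G`.
    · have hdvd : X 0 - C p ∣ r * sqPoly G := by
        rw [h, hF', absSqSub_eq, mul_assoc]
        exact dvd_mul_right _ _
      have hrdvd : X 0 - C p ∣ r := by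
        refine ((prime_X_zero_sub_C p).dvd_or_dvd hdvd).resolve_right ?_
        rintro ⟨t, ht⟩
        have hv := val_sqPoly G p
        rw [ht, val_mul] at hv
        refine hGp (Complex.ofReal_eq_zero.1 (hv.symm.trans ?_))
        simp [val, pol]
      obtain ⟨r', rfl⟩ := absSqSub_dvd hr hrdvd
      obtain ⟨K, q, s, h1, h2, h3⟩ := ih _ hdeg (r := r') (G := G)
        (mul_left_cancel₀ (absSqSub_ne_zero p) (by rw [← hF', ← h, mul_assoc])) hF'0 rfl
      refine ⟨K + 1, Fin.cons p q, s, ?_, ?_, h3⟩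
      · rw [Fin.range_cons, ← h1]
        ext z
        simp [sub_eq_zero, (starRingEnd ℂ).injective.eq_iff]
      · rw [Fin.prod_univ_succ]
        simp only [Fin.cons_zero, Fin.cons_succ]
        rw [mul_assoc, ← h2]
  · push Not at hz
    have hrne : ∀ z, val r z ≠ 0 := fun z h0 => hz z (by
      have := hval z
      rw [h0, zero_mul] at this
      exact_mod_cast this.symm)
    refine ⟨0, Fin.elim0, r, ?_, by simp, ⟨hr, fun z => ?_⟩, ?_⟩
    · ext z
      simp [hrne z]
    · have hre := congrArg Complex.re (hval z)
      rw [Complex.re_mul_ofReal, Complex.ofReal_re] at hre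
      have hpos : 0 < (val r z).re * sqNorm G z := by
        rw [hre]
        exact lt_of_le_of_ne (sqNorm_nonneg F z) (hz z).symm
      exact pos_of_mul_pos_left hpos (sqNorm_nonneg G z)
    -- Subtracting the degree relation of `sqPoly G` from that of the product leaves the relation
    -- for `r`.
    · have e1 := totalDegree_sqPoly hF
      have e2 := totalDegree_sqPoly hG0
      rw [← h, MvPolynomial.totalDegree_mul_of_isDomain hr0 hG0,
        MvPolynomial.degreeOf_mul_eq hr0 hG0] at e1
      omega

/-! ### From strict positivity to a quotient of squared norms -/

/-- A strictly positive polynomial whose total degree is twice its degree in `z` becomes a squared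
norm after multiplication by a power of `1 + |z|²`. -/
theorem IsStrictlyPositive.exists_sqNorm {s : BiPoly} (hs : IsStrictlyPositive s)
    (hdeg : MvPolynomial.totalDegree s = 2 * MvPolynomial.degreeOf 0 s) :
    ∃ (N m : ℕ) (F : Fin m → Polynomial ℂ), ∀ z : ℂ,
      (1 + z * conj z) ^ N * val s z = (sqNorm F z : ℂ) := by
  obtain ⟨hherm, hpos⟩ := hs
  have hc : ∀ a b, conj (MvPolynomial.coeff (biExp a b) s) = MvPolynomial.coeff (biExp b a) s := by
    intro a b
    rw [← coeff_hermConj, isHermitianSymm_iff.1 hherm]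
  have hs0 : s ≠ 0 := by
    rintro rfl
    simpa [val, pol] using hpos 0
  set d := MvPolynomial.degreeOf 0 s with hd
  have h0 : ∀ e ∈ s.support, e 0 ≤ d := MvPolynomial.degreeOf_le_iff.1 le_rfl
  have h1 : ∀ e ∈ s.support, e 1 ≤ d := by
    intro e he
    have : biExp (e 1) (e 0) ∈ s.support := by
      rw [MvPolynomial.mem_support_iff, ← hc, biExp_eta]
      simpa using he
    simpa using h0 _ this
  have hval : ∀ z, val s z = coeffVal (fun a b => MvPolynomial.coeff (biExp a b) s) d z :=
    fun z => eval_eq_sum_coeff le_rfl (MvPolynomial.degreeOf_le_iff.2 h1) z (conj z)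
  -- Some monomial attains total degree `2d` while both its exponents are at most `d`, so it is `z^d
  -- z̄^d`.
  have hdd : MvPolynomial.coeff (biExp d d) s ≠ 0 := by
    obtain ⟨e, he, hsum⟩ := Finset.exists_mem_eq_sup s.support
      (MvPolynomial.support_nonempty.2 hs0) fun e => e.sum fun _ k => k
    have hsum' : s.totalDegree = _ := hsum
    rw [← biExp_eta e, sum_biExp, hdeg] at hsum'
    have := h0 e he
    have := h1 e he
    rw [← MvPolynomial.mem_support_iff, ← show e = biExp d d by
      rw [← biExp_eta e, show e 0 = d by omega, show e 1 = d by omega]]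
    exact he
  obtain ⟨N, m, F, hF⟩ := exists_sqNorm_of_pos hc hdd fun z => by rw [← hval]; exact hpos z
  exact ⟨N, m, F, fun z => by rw [hval, hF]⟩

theorem IsHermitianSymm.pow {r : BiPoly} (hr : IsHermitianSymm r) (n : ℕ) :
    IsHermitianSymm (r ^ n) := by
  rw [isHermitianSymm_iff] at *
  rw [map_pow, hr]

theorem isHermitianSymm_one_add_X_mul_X : IsHermitianSymm (1 + X 0 * X 1) := by
  rw [isHermitianSymm_iff]
  simp [hermConj_apply, mul_comm]

theorem val_one_add_X_mul_X_pow (N : ℕ) (z : ℂ) :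
    val ((1 + X 0 * X 1) ^ N) z = (1 + z * conj z) ^ N := by
  simp [val, pol]

theorem one_add_X_mul_X_pow_mem_PInfty (N : ℕ) : ((1 + X 0 * X 1) ^ N : BiPoly) ∈ PInfty := by
  refine ⟨isHermitianSymm_one_add_X_mul_X.pow N, N + 1,
    fun k => Polynomial.monomial (k : ℕ) (√(N.choose k) : ℂ), fun z => ?_⟩
  rw [val_one_add_X_mul_X_pow, add_comm, add_pow, Finset.sum_range, sqNorm, Complex.ofReal_sum]
  refine Finset.sum_congr rfl fun k _ => ?_
  rw [Complex.mul_conj', Polynomial.eval_monomial, norm_mul, norm_pow, mul_pow, Complex.norm_real,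
    Real.norm_of_nonneg (Real.sqrt_nonneg _), Real.sq_sqrt (by positivity)]
  push_cast
  ring

theorem prod_absSqSub_mul_mem_PInfty {K : ℕ} (p : Fin K → ℂ) {t : BiPoly} (ht : t ∈ PInfty) :
    (∏ j, absSqSub (p j)) * t ∈ PInfty := by
  induction K with
  | zero => simpa using ht
  | succ K ih =>
    obtain ⟨N, F, hF⟩ := mem_PInfty_iff.1 (ih fun j => p j.succ)
    rw [Fin.prod_univ_succ, mul_assoc, hF, ← sqPoly_X_sub_C_mul]
    exact mem_PInfty_iff.2 ⟨N, _, rfl⟩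

end HermPoly

/-! ### The characterization -/

theorem corollary4p2 (r : HermPoly.BiPoly) (hr : HermPoly.IsHermitianSymm r) :
    r ∈ HermPoly.Q ↔
      r = 0 ∨
      ∃ (K : ℕ) (p : Fin K → ℂ) (s : HermPoly.BiPoly),
        {z : ℂ | HermPoly.val r z = 0} = Set.range p ∧
        r = (∏ j, HermPoly.absSqSub (p j)) * s ∧
        HermPoly.IsStrictlyPositive s ∧
        MvPolynomial.totalDegree s = 2 * MvPolynomial.degreeOf 0 s := by
  open HermPoly in
  constructor
  · rintro ⟨-, p, hp, q, hq, hq0, h⟩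
    refine or_iff_not_imp_left.2 fun hr0 => ?_
    obtain ⟨N, F, rfl⟩ := mem_PInfty_iff.1 hp
    obtain ⟨M, G, rfl⟩ := mem_PInfty_iff.1 hq
    have key : r * sqPoly G = sqPoly F := by
      -- The quotient identity is known only off the zeros of `G`; the extra factor `sqPoly G` makes
      -- it hold at every point and is then cancelled.
      have hmul : sqPoly G * (r * sqPoly G - sqPoly F) = sqPoly G * 0 := by
        refine eq_of_val_eq fun z => ?_
        rw [mul_zero, val_mul, val_sub, val_mul]
        by_cases hz : val (sqPoly G) z = 0
        · rw [hz, zero_mul]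
          simp [val, pol]
        · rw [h z hz, div_mul_cancel₀ _ hz]
          simp [val, pol]
      exact sub_eq_zero.1 (mul_left_cancel₀ hq0 hmul)
    exact exists_factorization key (key ▸ mul_ne_zero hr0 hq0)
  · rintro (rfl | ⟨K, p, s, -, hrs, hs, hdeg⟩)
    · refine ⟨hr, 0, mem_PInfty_iff.2 ⟨0, Fin.elim0, by simp [sqPoly]⟩, _,
        one_add_X_mul_X_pow_mem_PInfty 0, by simp, fun z _ => by simp [val, pol]⟩
    -- The denominator is `(1 + |z|²)^N`; the factors `|z - p_j|²` are absorbed by multiplying the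
    -- components of the numerator's mapping by `z - p_j`.
    · obtain ⟨N, m, F, hF⟩ := hs.exists_sqNorm hdeg
      have hne : ∀ z : ℂ, (1 + z * (starRingEnd ℂ) z) ^ N ≠ 0 := fun z => by
        rw [Complex.mul_conj']
        exact pow_ne_zero _ (by exact_mod_cast (by positivity : (1 + ‖z‖ ^ 2 : ℝ) ≠ 0))
      have hmem : (1 + MvPolynomial.X 0 * MvPolynomial.X 1) ^ N * s ∈ PInfty :=
        ⟨(isHermitianSymm_one_add_X_mul_X.pow N).mul hs.1, m, F, fun z => by
          rw [val_mul, val_one_add_X_mul_X_pow, hF]⟩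
      refine ⟨hr, _, prod_absSqSub_mul_mem_PInfty p hmem, _, one_add_X_mul_X_pow_mem_PInfty N,
        fun h0 => hne 0 ?_, fun z hz => ?_⟩
      · rw [← val_one_add_X_mul_X_pow, h0]; simp [val, pol]
      · rw [eq_div_iff hz, ← val_mul]
        congr 1
        rw [hrs]
        ring
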